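/- Let $(W,S)$ be a Coxeter system with Coxeter matrix $(m(s,t))$ and length function $\ell$. Let $W$ act on the real vector space $V$ with basis $\{\alpha_s : s\in S\}$ by $s\,v = v-2\langle v,\alpha_s\rangle\alpha_s$, where $\langle\cdot,\cdot\rangle$ is the symmetric bilinear form with $\langle\alpha_s,\alpha_t\rangle=-\cos(\pi/m(s,t))$ (equal to $-1$ if $m(s,t)=\infty$). Let $\Phi=\{u\alpha_s : u\in W, s\in S\}$ be the root system; a root is positive (resp. negative) if all its coefficients in the basis $\{\alpha_s\}$ are $\ge 0$ (resp. $\le 0$). For $w\in W$ let $\Phi(w)=\{\beta\in\Phi : \beta>0,\ w^{-1}\beta<0\}$ be its inversion set and let $\Phi^R(w)=\{-w\alpha_s : s\in S,\ \ell(ws)<\ell(w)\}$ be its set of right-descent roots. The right weak order on $W$ is defined by $x\preceq y$ if and only if $\ell(y)=\ell(x)+\ell(x^{-1}y)$. In a poset, a join representation of $x$ is an identity $x=\bigvee U$ (the join of $U$ exists and equals $x$). It is a canonical join representation if it is irredundant, that is, no proper subset of $U$ has join $x$, and if for every join representation $x=\bigvee V$ each $u\in U$ satisfies $u\le v$ for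 some $v\in V$. Theorem. Let $(W,S)$ be an arbitrary Coxeter system and let $w\in W$. For each $\beta\in\Phi^R(w)$ the set $\{v\in W : v\preceq w,\ \beta\in\Phi(v)\}$ has a unique element $j_\beta$ of minimal length. Moreover, $w=\bigvee\{j_\beta : \beta\in\Phi^R(w)\}$ is the canonical join representation of $w$ in the right weak order. -/

import Mathlib

/-! ### Canonical join representations in a poset -/

section Poset

variable {L : Type*} [PartialOrder L]

/-- `x = ⋁ U` is a join representation: the join of `U` exists and equals `x`. -/
def IsJoinRepresentation (U : Set L) (x : L) : Prop := IsLUB U x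

/-- The join representation `x = ⋁ U` is irredundant: no proper subset of `U` has join `x`. -/
def IsIrredundantJoin (U : Set L) (x : L) : Prop :=
  ∀ U' : Set L, U' ⊂ U → ¬ IsJoinRepresentation U' x

/-- The join-refinement relation `U << V`. -/
def JoinRefines (U V : Set L) : Prop := ∀ u ∈ U, ∃ v ∈ V, u ≤ v

/-- `x = ⋁ U` is a canonical join representation: it is an irredundant join representation, and `U`
join-refines every join representation of `x`. -/
structure IsCanonicalJoinRepresentation (U : Set L) (x : L) : Prop where
  isJoin : IsJoinRepresentation U x
  irredundant : IsIrredundantJoin U x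
  refines : ∀ V : Set L, IsJoinRepresentation V x → JoinRefines U V

end Poset

noncomputable section

/-! ### The geometric representation and the root system -/

namespace CoxeterMatrix

variable {B : Type*} (M : CoxeterMatrix B)

/-- The simple root `α_i`, a standard basis vector of the real vector space with basis `B`. -/
def simpleRoot (i : B) : B →₀ ℝ := Finsupp.single i 1

/-- The symmetric bilinear form with `⟨α_i, α_j⟩ = -cos (π / m(i, j))`. Mathlib encodes
`m(i, j) = ∞` by `M i j = 0`, and then the value is `-cos 0 = -1`, as it should be. -/
def form : (B →₀ ℝ) →ₗ[ℝ] (B →₀ ℝ) →ₗ[ℝ] ℝ :=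
  Finsupp.linearCombination ℝ fun i =>
    Finsupp.linearCombination ℝ fun j => -Real.cos (Real.pi / M i j)

theorem form_simpleRoot (i j : B) :
    M.form (simpleRoot i) (simpleRoot j) = -Real.cos (Real.pi / M i j) := by
  simp [form, simpleRoot]

/-- The linear functional `v ↦ 2 ⟨v, α_i⟩`. -/
def simpleCoroot (i : B) : Module.Dual ℝ (B →₀ ℝ) := (2 : ℝ) • M.form.flip (simpleRoot i)

theorem simpleCoroot_apply (i : B) (v : B →₀ ℝ) :
    M.simpleCoroot i v = 2 * M.form v (simpleRoot i) := by
  simp [simpleCoroot]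

theorem simpleCoroot_simpleRoot (i j : B) :
    M.simpleCoroot i (simpleRoot j) = -2 * Real.cos (Real.pi / M j i) := by
  rw [simpleCoroot_apply, form_simpleRoot]; ring

theorem simpleCoroot_self (i : B) : M.simpleCoroot i (simpleRoot i) = 2 := by
  simp [simpleCoroot_simpleRoot]

/-- The reflection `v ↦ v - 2 ⟨v, α_i⟩ α_i`. -/
def simpleReflection (i : B) : (B →₀ ℝ) ≃ₗ[ℝ] (B →₀ ℝ) :=
  Module.reflection (M.simpleCoroot_self i)

theorem simpleReflection_apply (i : B) (v : B →₀ ℝ) :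
    M.simpleReflection i v = v - (2 * M.form v (simpleRoot i)) • simpleRoot i := by
  rw [simpleReflection, Module.reflection_apply, simpleCoroot_apply]

/-- The Coxeter relations hold for the simple reflections. -/
theorem isLiftable_simpleReflection : M.IsLiftable M.simpleReflection := by
  intro i j
  by_cases hij : i = j
  · subst hij
    rw [M.diagonal, pow_one]
    ext1 v
    exact Module.involutive_reflection (M.simpleCoroot_self i) v
  have h1 : M i j ≠ 1 := M.off_diagonal i j hij
  have hfy := M.simpleCoroot_simpleRoot i j
  have hgx := M.simpleCoroot_simpleRoot j i
  rw [M.symmetric j i] at hfy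
  generalize hm : M i j = m at *
  ext1 v
  rw [simpleReflection, simpleReflection, Module.reflection_mul_reflection_pow_apply]
  rw [hfy, hgx]
  simp only [LinearEquiv.coe_one, id_eq]
  rcases Nat.lt_or_ge m 3 with hlt | hge
  · interval_cases m
    · simp
    · exact absurd rfl h1
    · norm_num
      module
  set θ : ℝ := Real.pi / m with hθ
  have hm0 : (0 : ℝ) < m := by positivity
  have ht : -2 * Real.cos θ * (-2 * Real.cos θ) - 2 = 2 * Real.cos (2 * θ) := by
    rw [Real.cos_two_mul]; ring
  have hmθ : m * θ = Real.pi := by rw [hθ]; field_simp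
  have hsin : Real.sin (2 * θ) ≠ 0 := by
    apply ne_of_gt
    have hge' : (3 : ℝ) ≤ m := by exact_mod_cast hge
    have hθ0 : 0 < θ := by positivity
    apply Real.sin_pos_of_pos_of_lt_pi <;> nlinarith
  rw [ht]
  have key (k : ℤ) : (Polynomial.Chebyshev.S ℝ k).eval (2 * Real.cos (2 * θ)) =
      Real.sin ((k + 1) * (2 * θ)) / Real.sin (2 * θ) := by
    rw [eq_div_iff hsin]
    exact Polynomial.Chebyshev.S_two_mul_real_cos _ _
  obtain ⟨k, hk | hk⟩ := Nat.even_or_odd' m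
  · have e1 : ((m : ℤ) - 2) / 2 = k - 1 := by omega
    have e2 : ((m : ℤ) - 1) / 2 = k - 1 := by omega
    have z : (Polynomial.Chebyshev.S ℝ ((k : ℤ) - 1)).eval (2 * Real.cos (2 * θ)) = 0 := by
      have : (((k : ℤ) - 1 : ℤ) + 1 : ℝ) * (2 * θ) = Real.pi := by
        rw [← hmθ, hk]; push_cast; ring
      rw [key, this]; simp
    rw [e1, e2, z]; simp
  · have e1 : ((m : ℤ) - 2) / 2 = k - 1 := by omega
    have e2 : ((m : ℤ) - 1) / 2 = k := by omega
    have e3 : ((m : ℤ) - 3) / 2 = k - 1 := by omega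
    have e4 : (m : ℤ) / 2 = k := by omega
    have z : (Polynomial.Chebyshev.S ℝ (k : ℤ)).eval (2 * Real.cos (2 * θ)) +
        (Polynomial.Chebyshev.S ℝ ((k : ℤ) - 1)).eval (2 * Real.cos (2 * θ)) = 0 := by
      have a1 : (((k : ℤ) : ℝ) + 1) * (2 * θ) = Real.pi + θ := by
        rw [← hmθ, hk]; push_cast; ring
      have a2 : (((k : ℤ) - 1 : ℤ) + 1 : ℝ) * (2 * θ) = Real.pi - θ := by
        rw [← hmθ, hk]; push_cast; ring
      rw [key, key, a1, a2, Real.sin_pi_sub, add_comm Real.pi, Real.sin_add_pi]; ring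
    rw [e1, e2, e3, e4, z]; simp

end CoxeterMatrix

namespace CoxeterSystem

open CoxeterMatrix

variable {B : Type*} {M : CoxeterMatrix B} {W : Type*} [Group W] (cs : CoxeterSystem M W)

/-- The action of `W` on the real vector space with basis the simple roots, determined by
`s_i v = v - 2 ⟨v, α_i⟩ α_i`. -/
def geometricRep : W →* ((B →₀ ℝ) ≃ₗ[ℝ] (B →₀ ℝ)) :=
  cs.lift ⟨M.simpleReflection, M.isLiftable_simpleReflection⟩

theorem geometricRep_simple_apply (i : B) (v : B →₀ ℝ) :
    cs.geometricRep (cs.simple i) v = v - (2 * M.form v (simpleRoot i)) • simpleRoot i := by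
  rw [geometricRep, lift_apply_simple, simpleReflection_apply]

/-- The root system `Φ = {u α_i | u ∈ W, i ∈ B}`. -/
def roots : Set (B →₀ ℝ) := {β | ∃ (u : W) (i : B), β = cs.geometricRep u (simpleRoot i)}

/-- The positive roots: all coefficients in the simple roots are `≥ 0`. -/
def positiveRoots : Set (B →₀ ℝ) := {β | β ∈ cs.roots ∧ ∀ i, 0 ≤ β i}

/-- The negative roots: all coefficients in the simple roots are `≤ 0`. -/
def negativeRoots : Set (B →₀ ℝ) := {β | β ∈ cs.roots ∧ ∀ i, β i ≤ 0}

/-- The (left) inversion set `Φ(w) = {β ∈ Φ⁺ | w⁻¹ β < 0}`. -/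
def inversionSet (w : W) : Set (B →₀ ℝ) :=
  {β | β ∈ cs.positiveRoots ∧ cs.geometricRep w⁻¹ β ∈ cs.negativeRoots}

/-- The right-descent roots `Φ^R(w) = {-w α_s | s ∈ D_R(w)}`. -/
def rightDescentRoots (w : W) : Set (B →₀ ℝ) :=
  {β | ∃ i : B, cs.IsRightDescent w i ∧ β = -cs.geometricRep w (simpleRoot i)}

/-! ### The right weak order -/

/-- The right weak order: `x ⪯ y` if and only if `ℓ(y) = ℓ(x) + ℓ(x⁻¹ y)`. -/
@[reducible] def rightWeakOrder : PartialOrder W where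
  le x y := cs.length y = cs.length x + cs.length (x⁻¹ * y)
  le_refl x := by simp
  le_trans x y z hxy hyz := by
    have h1 := cs.length_mul_le (x⁻¹ * y) (y⁻¹ * z)
    have h2 := cs.length_mul_le x (x⁻¹ * z)
    rw [show x⁻¹ * y * (y⁻¹ * z) = x⁻¹ * z by group] at h1
    rw [show x * (x⁻¹ * z) = z by group] at h2
    omega
  le_antisymm x y hxy hyx := by
    have h : cs.length (x⁻¹ * y) = 0 := by omega
    rw [length_eq_zero_iff] at h
    exact (inv_mul_eq_one.mp h)

/-- The set `{v | v ⪯ w, β ∈ Φ(v)}` of prefixes of `w` that have `β` as an inversion. -/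
def prefixesInverting (w : W) (β : B →₀ ℝ) : Set W :=
  {v | cs.rightWeakOrder.le v w ∧ β ∈ cs.inversionSet v}

/-- `j` is an element of `A` of minimal length. -/
def IsMinimalLengthIn (j : W) (A : Set W) : Prop :=
  j ∈ A ∧ ∀ v ∈ A, cs.length j ≤ cs.length v

/-- The set `{j_β | β ∈ Φ^R(w)}`, where `j_β` is the element of minimal length of
`{v | v ⪯ w, β ∈ Φ(v)}`. -/
def canonicalJoinands (w : W) : Set W :=
  {j | ∃ β ∈ cs.rightDescentRoots w, cs.IsMinimalLengthIn j (cs.prefixesInverting w β)}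

end CoxeterSystem

end

/-! The link between lengths and roots is that `w α_i` is positive exactly when `i` is not a right
descent of `w`; this comes from explicit dihedral orbits. Hence the right weak order is inclusion of
inversion sets, and passing from `w` down to `w s_i` loses only the inversion `β = -w α_i`.

The prefixes of `w` inverting `β` have a least element by Newman's lemma. If `x` covers two of them,
`x s_i` and `x s_j`, then `x = z b` with `b` longest in the dihedral subgroup, and `z` must invert
`β` too: otherwise the simple root `-w⁻¹ β` would be a positive combination of two distinct positive
roots (`mem_inversionSet_of_mem_both`).

For the join, let `y` bound all `j_β` and let `m` be the meet of `w` and `y`. If `m ≠ w`, then `m`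
lies below some `w s_i`, which does not invert its `β`, although `j_β` lies below `m`. Conversely,
if `w` is the join of `V`, some `v ∈ V` inverts `β`, for otherwise `w s_i` bounds `V`; then `j_β`
lies below `v`. Irredundance follows because the `j_β` form an antichain. -/

namespace CoxeterMatrix

variable {B : Type*} (M : CoxeterMatrix B)

/-! ### The bilinear form and dihedral coefficients -/

theorem form_comm (v w : B →₀ ℝ) : M.form v w = M.form w v := by
  have h : M.form = M.form.flip := by
    ext i j
    have := M.form_simpleRoot i j
    have h2 := M.form_simpleRoot j i
    rw [M.symmetric j i] at h2
    simp only [simpleRoot] at this h2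
    simp [this, h2]
  exact congrArg (fun f => f v w) h

theorem form_simpleRoot_self (i : B) : M.form (simpleRoot i) (simpleRoot i) = 1 := by
  simp [form_simpleRoot]

theorem two_le_of_ne {i j : B} (h : i ≠ j) (h0 : M i j ≠ 0) : 2 ≤ M i j := by
  have := M.off_diagonal i j h
  omega

/-- The coefficients that occur in the orbit of a simple root under a dihedral subgroup. -/
theorem exists_dihedral_coefficients {i j : B} (h : i ≠ j) :
    ∃ p : ℕ → ℝ, p 0 = 0 ∧ p 1 = 1 ∧
      (∀ k, p (k + 2) = 2 * Real.cos (Real.pi / M i j) * p (k + 1) - p k) ∧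
      ∀ k, (M i j = 0 ∨ k ≤ M i j) → 0 ≤ p k := by
  by_cases h0 : M i j = 0
  -- Here `m = ∞` and the cosine is `cos 0 = 1`, so the recursion is that of an arithmetic
  -- progression.
  · refine ⟨fun k => k, by simp, by simp, fun k => ?_, fun k _ => by positivity⟩
    simp [h0]
    ring
  have h2 := M.two_le_of_ne h h0
  generalize M i j = m at *
  have hm : (2 : ℝ) ≤ m := by exact_mod_cast h2
  have hpos : 0 < Real.pi / m := by positivity
  have hmul : m * (Real.pi / m) = Real.pi := by field_simp
  have hsin : 0 < Real.sin (Real.pi / m) :=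
    Real.sin_pos_of_pos_of_lt_pi hpos (by nlinarith [Real.pi_pos])
  generalize Real.pi / m = θ at *
  refine ⟨fun k => Real.sin (k * θ) / Real.sin θ, by simp, by simp [hsin.ne'], fun k => ?_,
    fun k hk => ?_⟩
  · have e : ((k + 2 : ℕ) : ℝ) * θ = ((k + 1 : ℕ) : ℝ) * θ + θ := by push_cast; ring
    have e' : (k : ℝ) * θ = ((k + 1 : ℕ) : ℝ) * θ - θ := by push_cast; ring
    simp only [e, e', Real.sin_add, Real.sin_sub]
    field_simp
    ring
  · have hk' : (k : ℝ) ≤ m := by exact_mod_cast hk.resolve_left h0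
    refine div_nonneg (Real.sin_nonneg_of_nonneg_of_le_pi (by positivity) ?_) hsin.le
    rw [← hmul]
    gcongr

end CoxeterMatrix

namespace CoxeterSystem

open CoxeterMatrix

variable {B : Type*} {M : CoxeterMatrix B} {W : Type*} [Group W] (cs : CoxeterSystem M W)

/-! ### Positivity of roots -/

theorem geometricRep_mul_apply (x y : W) (v : B →₀ ℝ) :
    cs.geometricRep (x * y) v = cs.geometricRep x (cs.geometricRep y v) := by
  rw [map_mul, LinearEquiv.mul_apply]

theorem geometricRep_one_apply (v : B →₀ ℝ) : cs.geometricRep 1 v = v := by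
  rw [map_one, LinearEquiv.coe_one, id]

theorem geometricRep_inv_apply_self (x : W) (v : B →₀ ℝ) :
    cs.geometricRep x⁻¹ (cs.geometricRep x v) = v := by
  rw [← geometricRep_mul_apply, inv_mul_cancel, geometricRep_one_apply]

theorem geometricRep_apply_inv_self (x : W) (v : B →₀ ℝ) :
    cs.geometricRep x (cs.geometricRep x⁻¹ v) = v := by
  rw [← geometricRep_mul_apply, mul_inv_cancel, geometricRep_one_apply]

theorem form_geometricRep (x : W) (v w : B →₀ ℝ) :
    M.form (cs.geometricRep x v) (cs.geometricRep x w) = M.form v w := by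
  induction x using cs.simple_induction_left generalizing v w with
  | one => simp only [geometricRep_one_apply]
  | mul_simple_left x i ih =>
    rw [geometricRep_mul_apply, geometricRep_mul_apply, geometricRep_simple_apply,
      geometricRep_simple_apply, ← ih v w]
    generalize cs.geometricRep x v = a
    generalize cs.geometricRep x w = b
    simp only [map_sub, map_smul, LinearMap.sub_apply, LinearMap.smul_apply, smul_eq_mul,
      form_simpleRoot_self, M.form_comm (simpleRoot i) b]
    ring

theorem form_self_of_mem_roots {β : B →₀ ℝ} (h : β ∈ cs.roots) : M.form β β = 1 := by
  obtain ⟨u, i, rfl⟩ := h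
  rw [form_geometricRep, form_simpleRoot_self]

theorem ne_zero_of_mem_roots {β : B →₀ ℝ} (h : β ∈ cs.roots) : β ≠ 0 := by
  rintro rfl
  simpa using cs.form_self_of_mem_roots h

theorem geometricRep_mem_roots (x : W) {β : B →₀ ℝ} (h : β ∈ cs.roots) :
    cs.geometricRep x β ∈ cs.roots := by
  obtain ⟨u, i, rfl⟩ := h
  exact ⟨x * u, i, (cs.geometricRep_mul_apply _ _ _).symm⟩

theorem geometricRep_simple_simpleRoot_self (i : B) :
    cs.geometricRep (cs.simple i) (simpleRoot i) = -simpleRoot i := by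
  rw [geometricRep_simple_apply, form_simpleRoot_self]
  module

theorem geometricRep_simple_simpleRoot (i j : B) :
    cs.geometricRep (cs.simple i) (simpleRoot j) =
      simpleRoot j + (2 * Real.cos (Real.pi / M i j)) • simpleRoot i := by
  rw [geometricRep_simple_apply, form_simpleRoot, M.symmetric j i]
  module

theorem neg_mem_roots {β : B →₀ ℝ} (h : β ∈ cs.roots) : -β ∈ cs.roots := by
  obtain ⟨u, i, rfl⟩ := h
  refine ⟨u * cs.simple i, i, ?_⟩
  rw [geometricRep_mul_apply, geometricRep_simple_simpleRoot_self, map_neg]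

theorem geometricRep_simple_apply_of_ne {i j : B} (h : j ≠ i) (v : B →₀ ℝ) :
    cs.geometricRep (cs.simple i) v j = v j := by
  simp [geometricRep_simple_apply, simpleRoot, h.symm]

theorem geometricRep_wordProd_apply_of_notMem {ω : List B} {j : B} (h : j ∉ ω) (v : B →₀ ℝ) :
    cs.geometricRep (cs.wordProd ω) v j = v j := by
  induction ω with
  | nil => simp
  | cons i ω ih =>
    rw [List.mem_cons, not_or] at h
    rw [wordProd_cons, geometricRep_mul_apply, geometricRep_simple_apply_of_ne _ h.1, ih h.2]

/-! ### Dihedral factorizations and the sign of a root -/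

theorem mem_alternatingWord {i i' j : B} {k : ℕ} (h : j ∈ alternatingWord i i' k) :
    j = i ∨ j = i' := by
  induction k generalizing i i' with
  | zero => simp [alternatingWord] at h
  | succ k ih =>
    rw [alternatingWord_succ, List.concat_eq_append, List.mem_append, List.mem_singleton] at h
    exact h.elim (fun h => (ih h).symm) Or.inr

theorem geometricRep_alternatingWord_simpleRoot {i j : B} {p : ℕ → ℝ} (h0 : p 0 = 0)
    (h1 : p 1 = 1) (hp : ∀ k, p (k + 2) = 2 * Real.cos (Real.pi / M i j) * p (k + 1) - p k)
    (k : ℕ) :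
    cs.geometricRep (cs.wordProd (alternatingWord i j k)) (simpleRoot i) =
      if Even k then p (k + 1) • simpleRoot i + p k • simpleRoot j
      else p (k + 1) • simpleRoot j + p k • simpleRoot i := by
  induction k with
  | zero => simp [alternatingWord, h0, h1]
  | succ k ih =>
    rw [alternatingWord_succ', wordProd_cons, geometricRep_mul_apply, ih]
    by_cases hk : Even k
    · have hk' : ¬ Even (k + 1) := by simpa [Nat.even_add_one] using hk
      simp only [hk, hk', if_true, if_false, map_add, map_smul,
        geometricRep_simple_simpleRoot_self, geometricRep_simple_simpleRoot, M.symmetric j i, hp]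
      module
    · have hk' : Even (k + 1) := by simpa [Nat.even_add_one] using hk
      simp only [hk, hk', if_true, if_false, map_add, map_smul,
        geometricRep_simple_simpleRoot_self, geometricRep_simple_simpleRoot, hp]
      module

/-- Split off an alternating suffix of maximal length `k`; then `z` is minimal in its coset of the
dihedral subgroup. -/
theorem exists_alternatingWord_factorization {x : W} {i j : B} (hx : cs.IsRightDescent x j) :
    ∃ z k, 0 < k ∧ x = z * cs.wordProd (alternatingWord i j k) ∧
      cs.length x = cs.length z + k ∧ ¬ cs.IsRightDescent z i ∧ ¬ cs.IsRightDescent z j := by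
  classical
  let P : ℕ → Prop := fun k => ∃ z, x = z * cs.wordProd (alternatingWord i j k) ∧
    cs.length x = cs.length z + k
  have hP1 : P 1 := by
    refine ⟨x * cs.simple j, ?_, ?_⟩
    · simp [alternatingWord]
    · rw [isRightDescent_iff] at hx; omega
  have hb : ∀ k, P k → k ≤ cs.length x := by
    rintro k ⟨z, -, h⟩; omega
  have hle := hb 1 hP1
  obtain ⟨z, hxz, hl⟩ : P (Nat.findGreatest P (cs.length x)) := Nat.findGreatest_spec hle hP1
  have hk1 : 1 ≤ Nat.findGreatest P (cs.length x) := Nat.le_findGreatest hle hP1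
  have hmax : ¬ P (Nat.findGreatest P (cs.length x) + 1) := fun h => by
    have := Nat.le_findGreatest (hb _ h) h
    omega
  generalize Nat.findGreatest P (cs.length x) = k at *
  have hfirst : ¬ cs.IsRightDescent z (if Even k then j else i) := by
    intro hz
    refine hmax ⟨z * cs.simple (if Even k then j else i), ?_, ?_⟩
    · rw [alternatingWord_succ', wordProd_cons, mul_assoc, simple_mul_simple_cancel_left, hxz]
    · rw [isRightDescent_iff] at hz; omega
  -- This letter is the first letter of the suffix, so it would cancel and give `x` an expression
  -- that is too short.
  have hother : ¬ cs.IsRightDescent z (if Even k then i else j) := by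
    intro hz
    obtain ⟨k, rfl⟩ : ∃ k', k = k' + 1 := ⟨k - 1, by omega⟩
    have e : (if Even (k + 1) then i else j) = if Even k then j else i := by
      by_cases hk : Even k <;> simp [hk, Nat.even_add_one]
    rw [e] at hz
    rw [alternatingWord_succ', wordProd_cons, ← mul_assoc] at hxz
    have h1 := cs.length_mul_le (z * cs.simple (if Even k then j else i))
      (cs.wordProd (alternatingWord i j k))
    have h2 := cs.length_wordProd_le (alternatingWord i j k)
    rw [length_alternatingWord] at h2
    rw [← hxz] at h1
    rw [isRightDescent_iff] at hz
    omega
  refine ⟨z, k, hk1, hxz, hl, ?_⟩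
  split_ifs at hfirst hother
  · exact ⟨hother, hfirst⟩
  · exact ⟨hfirst, hother⟩

theorem le_of_alternatingWord_factorization {x z : W} {i j : B} {k : ℕ} (hM : M i j ≠ 0)
    (hx : x = z * cs.wordProd (alternatingWord i j k)) (hl : cs.length x = cs.length z + k) :
    k ≤ M i j := by
  by_contra hk
  apply cs.not_isReduced_alternatingWord i j hM (not_le.1 hk)
  have h1 := cs.length_mul_le z (cs.wordProd (alternatingWord i j k))
  have h2 := cs.length_wordProd_le (alternatingWord i j k)
  rw [← hx] at h1
  rw [IsReduced]
  rw [length_alternatingWord] at *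
  omega

theorem coeff_nonneg_of_alternatingWord {z : W} {i j : B} {k : ℕ} (hij : i ≠ j)
    (hi : ∀ c, 0 ≤ cs.geometricRep z (simpleRoot i) c)
    (hj : ∀ c, 0 ≤ cs.geometricRep z (simpleRoot j) c) (hk : M i j = 0 ∨ k < M i j) (c : B) :
    0 ≤ cs.geometricRep (z * cs.wordProd (alternatingWord i j k)) (simpleRoot i) c := by
  obtain ⟨p, h0, h1, hp, hpos⟩ := M.exists_dihedral_coefficients hij
  have a := hpos k (hk.imp_right le_of_lt)
  -- The coefficient of index `k + 1` occurs, which is why `k < M i j` must be strict.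
  have b := hpos (k + 1) hk
  have := hi c
  have := hj c
  rw [geometricRep_mul_apply, cs.geometricRep_alternatingWord_simpleRoot h0 h1 hp]
  split_ifs <;>
  · simp only [map_add, map_smul, Finsupp.add_apply, Finsupp.smul_apply, smul_eq_mul]
    positivity

/-- The braid relation rewrites the suffix so that it ends in `i` instead of `j`. -/
theorem isRightDescent_of_mul_braidWord {x z : W} {i j : B} (hM : M i j ≠ 0)
    (hx : x = z * cs.wordProd (braidWord M i j)) (hl : cs.length x = cs.length z + M i j) :
    cs.IsRightDescent x i := by
  rw [wordProd_braidWord_eq, braidWord, M.symmetric j i] at hx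
  obtain ⟨m, hm⟩ := Nat.exists_eq_succ_of_ne_zero hM
  rw [hm] at hl hx
  rw [Nat.succ_eq_add_one, alternatingWord_succ, wordProd_concat, ← mul_assoc] at hx
  have h1 := cs.length_mul_le z (cs.wordProd (alternatingWord i j m))
  have h2 := cs.length_wordProd_le (alternatingWord i j m)
  rw [length_alternatingWord] at h2
  rw [IsRightDescent, hl, hx, simple_mul_simple_cancel_right]
  omega

/-- Induction on length: with `j` a descent of `w`, the coset factor `z` is shorter and has neither
`i` nor `j` as a descent. The suffix is shorter than `M i j`, since a full braid word would make `i`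
a descent. -/
theorem coeff_nonneg_of_not_isRightDescent {w : W} {i : B} (h : ¬ cs.IsRightDescent w i) :
    ∀ c, 0 ≤ cs.geometricRep w (simpleRoot i) c := by
  classical
  induction hn : cs.length w using Nat.strong_induction_on generalizing w i with
  | _ n ih =>
  by_cases hw : w = 1
  · subst hw
    intro c
    rw [geometricRep_one_apply, simpleRoot, Finsupp.single_apply]
    split_ifs <;> simp
  obtain ⟨j, hj⟩ := cs.exists_rightDescent_of_ne_one hw
  have hij : i ≠ j := by rintro rfl; exact h hj
  obtain ⟨z, k, hk, hwz, hl, hzi, hzj⟩ := cs.exists_alternatingWord_factorization (i := i) hj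
  have hkM : M i j = 0 ∨ k < M i j := by
    refine or_iff_not_imp_left.2 fun hM => ?_
    refine (cs.le_of_alternatingWord_factorization hM hwz hl).lt_of_ne ?_
    rintro rfl
    exact h (cs.isRightDescent_of_mul_braidWord hM hwz hl)
  rw [hwz]
  exact cs.coeff_nonneg_of_alternatingWord hij (ih _ (by omega) hzi rfl)
    (ih _ (by omega) hzj rfl) hkM

theorem mul_simple_isRightDescent_iff {w : W} {i : B} :
    cs.IsRightDescent (w * cs.simple i) i ↔ ¬ cs.IsRightDescent w i := by
  rw [isRightDescent_iff_not_isRightDescent_mul, simple_mul_simple_cancel_right]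

theorem geometricRep_mul_simple_simpleRoot (w : W) (i : B) :
    cs.geometricRep (w * cs.simple i) (simpleRoot i) = -cs.geometricRep w (simpleRoot i) := by
  rw [geometricRep_mul_apply, geometricRep_simple_simpleRoot_self, map_neg]

theorem geometricRep_simpleRoot_mem_positiveRoots_iff {w : W} {i : B} :
    cs.geometricRep w (simpleRoot i) ∈ cs.positiveRoots ↔ ¬ cs.IsRightDescent w i := by
  refine ⟨fun h hd => ?_, fun h => ⟨⟨w, i, rfl⟩, cs.coeff_nonneg_of_not_isRightDescent h⟩⟩
  have h1 := cs.coeff_nonneg_of_not_isRightDescent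
    (cs.isRightDescent_iff_not_isRightDescent_mul.1 hd)
  refine cs.ne_zero_of_mem_roots h.1 (Finsupp.ext fun c => le_antisymm ?_ (h.2 c))
  have := h1 c
  rw [geometricRep_mul_simple_simpleRoot, Finsupp.neg_apply] at this
  simpa using this

theorem neg_mem_positiveRoots_iff {β : B →₀ ℝ} : -β ∈ cs.positiveRoots ↔ β ∈ cs.negativeRoots := by
  refine ⟨fun h => ⟨by simpa using cs.neg_mem_roots h.1, fun i => by simpa using h.2 i⟩,
    fun h => ⟨cs.neg_mem_roots h.1, fun i => by simpa using h.2 i⟩⟩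

theorem geometricRep_simpleRoot_mem_negativeRoots_iff {w : W} {i : B} :
    cs.geometricRep w (simpleRoot i) ∈ cs.negativeRoots ↔ cs.IsRightDescent w i := by
  rw [← neg_mem_positiveRoots_iff, ← geometricRep_mul_simple_simpleRoot,
    geometricRep_simpleRoot_mem_positiveRoots_iff, ← isRightDescent_iff_not_isRightDescent_mul]

theorem mem_positiveRoots_or_mem_negativeRoots {β : B →₀ ℝ} (h : β ∈ cs.roots) :
    β ∈ cs.positiveRoots ∨ β ∈ cs.negativeRoots := by
  obtain ⟨w, i, rfl⟩ := h
  rw [geometricRep_simpleRoot_mem_positiveRoots_iff, geometricRep_simpleRoot_mem_negativeRoots_iff]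
  exact (em _).symm

theorem notMem_negativeRoots_of_mem_positiveRoots {β : B →₀ ℝ} (h : β ∈ cs.positiveRoots) :
    β ∉ cs.negativeRoots := fun h' =>
  cs.ne_zero_of_mem_roots h.1 (Finsupp.ext fun c => le_antisymm (h'.2 c) (h.2 c))

theorem simpleRoot_mem_positiveRoots (i : B) : simpleRoot i ∈ cs.positiveRoots := by
  have := cs.geometricRep_simpleRoot_mem_positiveRoots_iff.2 (cs.not_isRightDescent_one i)
  rwa [geometricRep_one_apply] at this

/-- Roots have norm one, so the only positive multiple of `α_i` that is a root is `α_i`. -/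
theorem eq_simpleRoot_of_mem_positiveRoots {β : B →₀ ℝ} {i : B} (h : β ∈ cs.positiveRoots)
    (hβ : ∀ c, c ≠ i → β c = 0) : β = simpleRoot i := by
  classical
  have e : β = β i • simpleRoot i := by
    ext c
    by_cases hc : c = i
    · subst hc; simp [simpleRoot]
    · simp [simpleRoot, hβ c hc, Ne.symm hc]
  have h1 := cs.form_self_of_mem_roots h.1
  rw [e] at h1
  simp only [map_smul, LinearMap.smul_apply, form_simpleRoot_self, smul_eq_mul, mul_one] at h1
  have h2 : β i = 1 := by nlinarith [h.2 i]
  rw [e, h2, one_smul]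

/-- The reflection changes only the coefficient at `i`, so the sign can flip only if all other
coefficients vanish. -/
theorem geometricRep_simple_mem_negativeRoots {β : B →₀ ℝ} {i : B} (h : β ∈ cs.negativeRoots)
    (hβ : β ≠ -simpleRoot i) : cs.geometricRep (cs.simple i) β ∈ cs.negativeRoots := by
  refine (cs.mem_positiveRoots_or_mem_negativeRoots
    (cs.geometricRep_mem_roots _ h.1)).resolve_left fun hp => hβ ?_
  rw [← neg_eq_iff_eq_neg]
  refine cs.eq_simpleRoot_of_mem_positiveRoots (cs.neg_mem_positiveRoots_iff.2 h) fun c hc => ?_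
  have h1 := hp.2 c
  rw [geometricRep_simple_apply_of_ne _ hc] at h1
  rw [Finsupp.neg_apply, le_antisymm (h.2 c) h1, neg_zero]

/-! ### Inversion sets and the weak order -/

theorem inversionSet_subset_inversionSet_mul_simple {w : W} {i : B}
    (h : ¬ cs.IsRightDescent w i) :
    cs.inversionSet w ⊆ cs.inversionSet (w * cs.simple i) := by
  rintro β ⟨hβ, hn⟩
  refine ⟨hβ, ?_⟩
  rw [mul_inv_rev, inv_simple, geometricRep_mul_apply]
  refine cs.geometricRep_simple_mem_negativeRoots hn fun e => ?_
  have h2 := congrArg (cs.geometricRep w) e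
  rw [geometricRep_apply_inv_self, map_neg] at h2
  rw [h2, neg_mem_positiveRoots_iff, geometricRep_simpleRoot_mem_negativeRoots_iff] at hβ
  exact h hβ

theorem mem_inversionSet_mul_simple {w : W} {i : B} {β : B →₀ ℝ} (hβ : β ∈ cs.inversionSet w)
    (hne : β ≠ -cs.geometricRep w (simpleRoot i)) :
    β ∈ cs.inversionSet (w * cs.simple i) := by
  refine ⟨hβ.1, ?_⟩
  rw [mul_inv_rev, inv_simple, geometricRep_mul_apply]
  refine cs.geometricRep_simple_mem_negativeRoots hβ.2 fun e => hne ?_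
  have h2 := congrArg (cs.geometricRep w) e
  rwa [geometricRep_apply_inv_self, map_neg] at h2

theorem neg_geometricRep_simpleRoot_mem_inversionSet {w : W} {i : B}
    (h : cs.IsRightDescent w i) : -cs.geometricRep w (simpleRoot i) ∈ cs.inversionSet w := by
  refine ⟨by rwa [neg_mem_positiveRoots_iff, geometricRep_simpleRoot_mem_negativeRoots_iff], ?_⟩
  rw [map_neg, geometricRep_inv_apply_self, ← neg_mem_positiveRoots_iff, neg_neg]
  exact cs.simpleRoot_mem_positiveRoots i

theorem neg_geometricRep_simpleRoot_notMem_inversionSet_mul_simple (w : W) (i : B) :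
    -cs.geometricRep w (simpleRoot i) ∉ cs.inversionSet (w * cs.simple i) := by
  rintro ⟨-, h⟩
  rw [← geometricRep_mul_simple_simpleRoot, geometricRep_inv_apply_self] at h
  exact cs.notMem_negativeRoots_of_mem_positiveRoots (cs.simpleRoot_mem_positiveRoots i) h

local notation:50 x:51 " ≼[" cs "] " y:51 => 
  @LE.le _ (@Preorder.toLE _ (@PartialOrder.toPreorder _ (rightWeakOrder cs))) x y

theorem weak_le_iff {x y : W} :
    x ≼[cs] y ↔ cs.length y = cs.length x + cs.length (x⁻¹ * y) := Iff.rfl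

theorem weak_le_mul_iff {x y : W} :
    x ≼[cs] x * y ↔ cs.length (x * y) = cs.length x + cs.length y := by
  rw [weak_le_iff, inv_mul_cancel_left]

theorem weak_mul_simple_le {w : W} {i : B} (h : cs.IsRightDescent w i) :
    w * cs.simple i ≼[cs] w := by
  rw [isRightDescent_iff] at h
  rw [weak_le_iff, mul_inv_rev, inv_mul_cancel_right, inv_simple, length_simple, h]

theorem weak_le_mul_simple {w : W} {i : B} (h : ¬ cs.IsRightDescent w i) :
    w ≼[cs] w * cs.simple i := by
  rw [not_isRightDescent_iff] at h
  rw [weak_le_mul_iff, length_simple, h]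

/-- If `x ≺ y`, then `x` lies below some element covered by `y`. -/
theorem exists_weak_le_mul_simple {x y : W} (h : x ≼[cs] y) (hne : x ≠ y) :
    ∃ i, cs.IsRightDescent y i ∧ x ≼[cs] y * cs.simple i := by
  have h1 : x⁻¹ * y ≠ 1 := fun e => hne (inv_mul_eq_one.1 e)
  obtain ⟨i, hi⟩ := cs.exists_rightDescent_of_ne_one h1
  rw [isRightDescent_iff] at hi
  rw [weak_le_iff] at h
  have h2 := cs.length_mul_le x (x⁻¹ * y * cs.simple i)
  rw [show x * (x⁻¹ * y * cs.simple i) = y * cs.simple i by group] at h2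
  have h3 := cs.length_mul_simple y i
  refine ⟨i, ?_, ?_⟩
  · rw [isRightDescent_iff]; omega
  · rw [weak_le_iff, ← mul_assoc]; omega

/-- If `x ≺ y`, then some element covering `x` lies below `y`. -/
theorem exists_mul_simple_weak_le {x y : W} (h : x ≼[cs] y) (hne : x ≠ y) :
    ∃ i, ¬ cs.IsRightDescent x i ∧ x * cs.simple i ≼[cs] y := by
  have h1 : x⁻¹ * y ≠ 1 := fun e => hne (inv_mul_eq_one.1 e)
  obtain ⟨i, hi⟩ := cs.exists_leftDescent_of_ne_one h1
  rw [isLeftDescent_iff] at hi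
  rw [weak_le_iff] at h
  have h2 := cs.length_mul_le (x * cs.simple i) (cs.simple i * (x⁻¹ * y))
  rw [show x * cs.simple i * (cs.simple i * (x⁻¹ * y)) = y by
    rw [mul_assoc, simple_mul_simple_cancel_left, mul_inv_cancel_left]] at h2
  have h3 := cs.length_mul_simple x i
  refine ⟨i, ?_, ?_⟩
  · rw [not_isRightDescent_iff]; omega
  · rw [weak_le_iff, mul_inv_rev, inv_simple, mul_assoc]; omega

theorem inversionSet_mono {x y : W} (h : x ≼[cs] y) : cs.inversionSet x ⊆ cs.inversionSet y := by
  induction hn : cs.length y generalizing y with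
  | zero =>
    by_cases hxy : x = y
    · rw [hxy]
    obtain ⟨i, hi, -⟩ := cs.exists_weak_le_mul_simple h hxy
    rw [isRightDescent_iff] at hi; omega
  | succ n ih =>
    by_cases hxy : x = y
    · rw [hxy]
    obtain ⟨i, hi, hle⟩ := cs.exists_weak_le_mul_simple h hxy
    have h1 := cs.inversionSet_subset_inversionSet_mul_simple
      (cs.isRightDescent_iff_not_isRightDescent_mul.1 hi)
    rw [simple_mul_simple_cancel_right] at h1
    rw [isRightDescent_iff] at hi
    exact (ih hle (by omega)).trans h1

theorem geometricRep_simpleRoot_mem_inversionSet_of_weak_le {x y : W} {i : B}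
    (hx : ¬ cs.IsRightDescent x i) (h : x * cs.simple i ≼[cs] y) :
    cs.geometricRep x (simpleRoot i) ∈ cs.inversionSet y := by
  refine cs.inversionSet_mono h ?_
  have := cs.neg_geometricRep_simpleRoot_mem_inversionSet (cs.mul_simple_isRightDescent_iff.2 hx)
  rwa [geometricRep_mul_simple_simpleRoot, neg_neg] at this

theorem mul_simple_weak_le_of_mem_inversionSet {x y : W} {i : B} (hx : ¬ cs.IsRightDescent x i)
    (h : x ≼[cs] y) (hi : cs.geometricRep x (simpleRoot i) ∈ cs.inversionSet y) :
    x * cs.simple i ≼[cs] y := by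
  -- Negativity of `y⁻¹ x α_i` says that `i` is a left descent of `x⁻¹ * y`.
  have h1 := hi.2
  rw [← geometricRep_mul_apply, geometricRep_simpleRoot_mem_negativeRoots_iff,
    ← isLeftDescent_inv_iff, mul_inv_rev, inv_inv, isLeftDescent_iff] at h1
  rw [not_isRightDescent_iff] at hx
  rw [weak_le_iff] at h ⊢
  rw [mul_inv_rev, inv_simple, mul_assoc]
  omega

/-- Climb from `1` to `x` through covers: each step adds a root of `Φ(x)`, hence of `Φ(y)`, so the
chain stays below `y`. -/
theorem weak_le_of_inversionSet_subset {x y : W} (h : cs.inversionSet x ⊆ cs.inversionSet y) :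
    x ≼[cs] y := by
  suffices H : ∀ n z, z ≼[cs] x → z ≼[cs] y → cs.length x = cs.length z + n → x ≼[cs] y by
    refine H (cs.length x) 1 ?_ ?_ (by simp) <;> simp [weak_le_iff]
  intro n
  induction n with
  | zero =>
    intro z hzx hzy hl
    rw [weak_le_iff] at hzx
    have : z⁻¹ * x = 1 := cs.length_eq_zero_iff.1 (by omega)
    rwa [← inv_mul_eq_one.1 this]
  | succ n ih =>
    intro z hzx hzy hl
    have hne : z ≠ x := by rintro rfl; omega
    obtain ⟨i, hi, hle⟩ := cs.exists_mul_simple_weak_le hzx hne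
    refine ih _ hle (cs.mul_simple_weak_le_of_mem_inversionSet hi hzy
      (h (cs.geometricRep_simpleRoot_mem_inversionSet_of_weak_le hi hle))) ?_
    rw [not_isRightDescent_iff] at hi
    omega

/-! ### Rank two intervals -/

/-- An element with two right descents is divisible by the longest element of the
(necessarily finite) dihedral subgroup that they generate. -/
theorem exists_eq_mul_braidWord {x : W} {i j : B} (hij : i ≠ j) (hi : cs.IsRightDescent x i)
    (hj : cs.IsRightDescent x j) : M i j ≠ 0 ∧ ∃ z,
      x = z * cs.wordProd (braidWord M i j) ∧ cs.length x = cs.length z + M i j := by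
  obtain ⟨z, k, hk, hxz, hl, hzi, hzj⟩ := cs.exists_alternatingWord_factorization (i := i) hj
  -- A shorter suffix would keep `x α_i` positive, contrary to `hi`.
  have hkM : ¬ (M i j = 0 ∨ k < M i j) := fun hkM => by
    have h1 := cs.coeff_nonneg_of_alternatingWord hij (cs.coeff_nonneg_of_not_isRightDescent hzi)
      (cs.coeff_nonneg_of_not_isRightDescent hzj) hkM
    rw [← hxz] at h1
    exact cs.geometricRep_simpleRoot_mem_positiveRoots_iff.1 ⟨⟨x, i, rfl⟩, h1⟩ hi
  rw [not_or] at hkM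
  obtain rfl := (cs.le_of_alternatingWord_factorization hkM.1 hxz hl).antisymm (not_lt.1 hkM.2)
  exact ⟨hkM.1, z, hxz, hl⟩

theorem weak_le_mul_simple_of_braidWord {x z : W} {i j : B} (hM : M i j ≠ 0)
    (hx : x = z * cs.wordProd (braidWord M i j)) (hl : cs.length x = cs.length z + M i j) :
    z ≼[cs] x * cs.simple j := by
  obtain ⟨m, hm⟩ := Nat.exists_eq_succ_of_ne_zero hM
  rw [braidWord, hm, Nat.succ_eq_add_one, alternatingWord_succ, wordProd_concat, ← mul_assoc] at hx
  rw [hx, simple_mul_simple_cancel_right, weak_le_mul_iff]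
  have h1 := cs.length_mul_le z (cs.wordProd (alternatingWord j i m))
  have h2 := cs.length_wordProd_le (alternatingWord j i m)
  have h3 := cs.length_mul_le (z * cs.wordProd (alternatingWord j i m)) (cs.simple j)
  rw [length_alternatingWord] at h2
  rw [length_simple, ← hx] at h3
  omega

theorem length_simple_mul_inv_braidWord {i j : B} (hM : M i j ≠ 0) :
    cs.length (cs.simple j * (cs.wordProd (braidWord M i j))⁻¹) + 1 ≤ M i j := by
  obtain ⟨m, hm⟩ := Nat.exists_eq_succ_of_ne_zero hM
  have h := cs.length_wordProd_le (alternatingWord j i m)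
  rw [length_alternatingWord] at h
  rw [← length_inv, mul_inv_rev, inv_inv, inv_simple, braidWord, hm, Nat.succ_eq_add_one,
    alternatingWord_succ, wordProd_concat, simple_mul_simple_cancel_right]
  omega

/-- Both `i` and `j` are left descents of `z⁻¹ * x`, so its inverse ends in the braid word. The
element obtained does not depend on `x`, hence lies below every common upper bound. -/
theorem mul_inv_braidWord_weak_le {z x : W} {i j : B} (hij : i ≠ j)
    (hi : ¬ cs.IsRightDescent z i) (hj : ¬ cs.IsRightDescent z j)
    (hix : z * cs.simple i ≼[cs] x) (hjx : z * cs.simple j ≼[cs] x) :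
    M i j ≠ 0 ∧ z * (cs.wordProd (braidWord M i j))⁻¹ ≼[cs] x ∧
      cs.length (z * (cs.wordProd (braidWord M i j))⁻¹) = cs.length z + M i j := by
  have key (k : B) (hk : ¬ cs.IsRightDescent z k) (hkx : z * cs.simple k ≼[cs] x) :
      z ≼[cs] x ∧ cs.IsRightDescent (z⁻¹ * x)⁻¹ k := by
    have h1 := (rightWeakOrder cs).le_trans _ _ _ (cs.weak_le_mul_simple hk) hkx
    refine ⟨h1, ?_⟩
    rw [isRightDescent_inv_iff, isLeftDescent_iff]
    rw [not_isRightDescent_iff] at hk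
    rw [weak_le_iff] at h1 hkx
    rw [mul_inv_rev, inv_simple, mul_assoc] at hkx
    omega
  obtain ⟨hzx, hdi⟩ := key i hi hix
  obtain ⟨hM, u, hu, hul⟩ := cs.exists_eq_mul_braidWord hij hdi (key j hj hjx).2
  refine ⟨hM, ?_⟩
  have hbl := cs.length_wordProd_le (braidWord M i j)
  rw [braidWord, length_alternatingWord, ← braidWord] at hbl
  generalize cs.wordProd (braidWord M i j) = b at *
  have e : x = z * b⁻¹ * u⁻¹ := by
    rw [mul_assoc, ← mul_inv_rev, ← hu, inv_inv, mul_inv_cancel_left]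
  rw [weak_le_iff, ← length_inv cs (z⁻¹ * x), hul] at hzx
  have h1 := cs.length_mul_le z b⁻¹
  have h2 := cs.length_mul_le (z * b⁻¹) u⁻¹
  rw [← e] at h2
  rw [length_inv] at h1 h2
  refine ⟨?_, by omega⟩
  rw [e, weak_le_mul_iff, ← e, length_inv]
  omega

/-- If two elements covering `z` have an upper bound, then they have a join. -/
theorem exists_isLUB_of_two_covers {z x : W} {i j : B} (hij : i ≠ j)
    (hi : ¬ cs.IsRightDescent z i) (hj : ¬ cs.IsRightDescent z j)
    (hix : z * cs.simple i ≼[cs] x) (hjx : z * cs.simple j ≼[cs] x) :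
    ∃ y, z * cs.simple i ≼[cs] y ∧ z * cs.simple j ≼[cs] y ∧
      ∀ x', z * cs.simple i ≼[cs] x' → z * cs.simple j ≼[cs] x' → y ≼[cs] x' := by
  obtain ⟨hM, -, hl⟩ := cs.mul_inv_braidWord_weak_le hij hi hj hix hjx
  have hshort_j := cs.length_simple_mul_inv_braidWord hM
  have hshort_i := cs.length_simple_mul_inv_braidWord (M.symmetric i j ▸ hM)
  rw [wordProd_braidWord_eq, M.symmetric j i] at hshort_i
  have hcov (k : B) (hk : ¬ cs.IsRightDescent z k)
      (hs : cs.length (cs.simple k * (cs.wordProd (braidWord M i j))⁻¹) + 1 ≤ M i j) :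
      z * cs.simple k ≼[cs] z * (cs.wordProd (braidWord M i j))⁻¹ := by
    rw [weak_le_iff, mul_inv_rev, inv_simple, mul_assoc, inv_mul_cancel_left]
    rw [not_isRightDescent_iff] at hk
    have h3 := cs.length_mul_le (z * cs.simple k)
      (cs.simple k * (cs.wordProd (braidWord M i j))⁻¹)
    rw [mul_assoc, simple_mul_simple_cancel_left] at h3
    omega
  exact ⟨_, hcov i hi hshort_i, hcov j hj hshort_j, fun x' hi' hj' =>
    (cs.mul_inv_braidWord_weak_le hij hi hj hi' hj').2.1⟩

/-! ### Meets, and least prefixes with a given inversion -/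

/-- A form of Newman's lemma. -/
theorem exists_forall_le_of_locally_confluent {P : Type*} (le cover : P → P → Prop)
    (hrefl : ∀ x, le x x) (htrans : ∀ x y z, le x y → le y z → le x z) (A : Set P) (f : P → ℕ)
    (hf : ∀ x ∈ A, ∀ y ∈ A, cover y x → f y < f x) (hle : ∀ x y, cover y x → le y x)
    (hcover : ∀ x ∈ A, ∀ v ∈ A, le v x → v ≠ x → ∃ y ∈ A, cover y x ∧ le v y)
    (hconf : ∀ x ∈ A, ∀ y ∈ A, ∀ y' ∈ A, cover y x → cover y' x → ∃ z ∈ A, le z y ∧ le z y')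
    {x : P} (hx : x ∈ A) : ∃ j ∈ A, le j x ∧ ∀ v ∈ A, le v x → le j v := by
  induction hn : f x using Nat.strong_induction_on generalizing x with
  | _ n ih =>
  by_cases h : ∃ y ∈ A, cover y x
  · obtain ⟨y, hy, hyx⟩ := h
    obtain ⟨j, hj, hjy, hmin⟩ := ih _ (hn ▸ hf x hx y hy hyx) hy rfl
    refine ⟨j, hj, htrans _ _ _ hjy (hle _ _ hyx), fun v hv hvx => ?_⟩
    by_cases hne : v = x
    · exact hne ▸ htrans _ _ _ hjy (hle _ _ hyx)
    obtain ⟨y', hy', hyx', hvy'⟩ := hcover x hx v hv hvx hne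
    obtain ⟨j', hj', hjy', hmin'⟩ := ih _ (hn ▸ hf x hx y' hy' hyx') hy' rfl
    -- Since `j' ≤ z ≤ y`, minimality of `j` gives `j ≤ j'`, and `j' ≤ v`.
    obtain ⟨z, hz, hzy, hzy'⟩ := hconf x hx y hy y' hy' hyx hyx'
    exact htrans _ _ _ (hmin j' hj' (htrans _ _ _ (hmin' z hz hzy') hzy)) (hmin' v hv hvy')
  · refine ⟨x, hx, hrefl x, fun v hv hvx => ?_⟩
    by_cases hne : v = x
    · exact hne ▸ hrefl x
    · obtain ⟨y, hy, hyx, -⟩ := hcover x hx v hv hvx hne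
      exact absurd ⟨y, hy, hyx⟩ h

theorem length_le_of_weak_le {x y : W} (h : x ≼[cs] y) : cs.length x ≤ cs.length y := by
  rw [weak_le_iff] at h
  omega

theorem eq_of_weak_le_of_length_le {x y : W} (h : x ≼[cs] y) (hl : cs.length y ≤ cs.length x) :
    x = y := by
  rw [weak_le_iff] at h
  exact inv_mul_eq_one.1 (cs.length_eq_zero_iff.1 (by omega))

/-- The right weak order is a meet semilattice. -/
theorem exists_weak_meet (x y : W) :
    ∃ m, m ≼[cs] x ∧ m ≼[cs] y ∧ ∀ z, z ≼[cs] x → z ≼[cs] y → z ≼[cs] m := by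
  have hone (v : W) : 1 ≼[cs] v := by simp [weak_le_iff]
  have htrans {a b c : W} (h : a ≼[cs] b) (h' : b ≼[cs] c) : a ≼[cs] c :=
    (rightWeakOrder cs).le_trans _ _ _ h h'
  -- Newman's lemma in the reversed order, climbing from `1` through the common prefixes; confluence
  -- is the join of two covers.
  obtain ⟨m, hm, -, hmax⟩ := exists_forall_le_of_locally_confluent
    (fun a b => b ≼[cs] a) (fun a b => ∃ i, ¬ cs.IsRightDescent b i ∧ a = b * cs.simple i)
    (rightWeakOrder cs).le_refl (fun _ _ _ h h' => htrans h' h)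
    {z | z ≼[cs] x ∧ z ≼[cs] y} (fun z => cs.length x - cs.length z)
    (by
      rintro a ⟨hax, -⟩ _ ⟨hbx, -⟩ ⟨i, hi, rfl⟩
      have := cs.length_le_of_weak_le hbx
      rw [not_isRightDescent_iff] at hi
      omega)
    (by
      rintro a _ ⟨i, hi, rfl⟩
      exact cs.weak_le_mul_simple hi)
    (by
      rintro a - v ⟨hvx, hvy⟩ hav hne
      obtain ⟨i, hi, hle⟩ := cs.exists_mul_simple_weak_le hav hne.symm
      exact ⟨_, ⟨htrans hle hvx, htrans hle hvy⟩, ⟨i, hi, rfl⟩, hle⟩)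
    (by
      rintro a - _ ⟨hix, hiy⟩ _ ⟨hjx, hjy⟩ ⟨i, hi, rfl⟩ ⟨j, hj, rfl⟩
      by_cases hij : i = j
      · subst hij
        exact ⟨_, ⟨hix, hiy⟩, (rightWeakOrder cs).le_refl _, (rightWeakOrder cs).le_refl _⟩
      obtain ⟨y', hiy', hjy', hmin⟩ := cs.exists_isLUB_of_two_covers hij hi hj hix hjx
      exact ⟨y', ⟨hmin x hix hjx, hmin y hiy hjy⟩, hiy', hjy'⟩)
    (x := 1) ⟨hone x, hone y⟩
  exact ⟨m, hm.1, hm.2, fun z hzx hzy => hmax z ⟨hzx, hzy⟩ (hone z)⟩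

/-- The confluence step for prefixes inverting `β`. If `z⁻¹ β` were positive, `-x⁻¹ β` would be a
combination of `α_i` and `α_j` with both coefficients positive; applying `w⁻¹ x` then decomposes a
simple root. -/
theorem mem_inversionSet_of_mem_both {x w z : W} {i i' j : B} (hxw : x ≼[cs] w) (hij : i ≠ j)
    (hi : cs.IsRightDescent x i) (hj : cs.IsRightDescent x j)
    (hx : x = z * cs.wordProd (braidWord M i j))
    (hβi : -cs.geometricRep w (simpleRoot i') ∈ cs.inversionSet (x * cs.simple i))
    (hβj : -cs.geometricRep w (simpleRoot i') ∈ cs.inversionSet (x * cs.simple j)) :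
    -cs.geometricRep w (simpleRoot i') ∈ cs.inversionSet z := by
  classical
  set β := -cs.geometricRep w (simpleRoot i') with hβ
  have hβx : β ∈ cs.inversionSet x := cs.inversionSet_mono (cs.weak_mul_simple_le hi) hβi
  refine ⟨hβx.1, (cs.mem_positiveRoots_or_mem_negativeRoots
    (cs.geometricRep_mem_roots _ hβx.1.1)).resolve_left fun hpos => ?_⟩
  -- The negative root `x⁻¹ β` is supported on `{i, j}`.
  set δ := -cs.geometricRep x⁻¹ β with hδ
  have hδpos : δ ∈ cs.positiveRoots := cs.neg_mem_positiveRoots_iff.2 hβx.2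
  have hsupp (c : B) (hci : c ≠ i) (hcj : c ≠ j) : δ c = 0 := by
    refine le_antisymm ?_ (hδpos.2 c)
    have h1 := hpos.2 c
    -- A word in `i` and `j` fixes all other coefficients, so those of `x⁻¹ β` are both nonnegative
    -- and nonpositive.
    have h2 : cs.geometricRep z⁻¹ β =
        cs.geometricRep (cs.wordProd (braidWord M i j)) (cs.geometricRep x⁻¹ β) := by
      rw [← geometricRep_mul_apply, hx, mul_inv_rev, mul_inv_cancel_left]
    rw [h2, geometricRep_wordProd_apply_of_notMem] at h1
    · simpa [hδ] using h1
    · exact fun h => (mem_alternatingWord h).elim hci hcj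
  have hδeq : δ = δ i • simpleRoot i + δ j • simpleRoot j := by
    ext c
    by_cases hci : c = i
    · subst hci; simp [simpleRoot, hij]
    by_cases hcj : c = j
    · subst hcj; simp [simpleRoot, hij]
    simp [simpleRoot, hsupp c hci hcj, Ne.symm hci, Ne.symm hcj]
  have hxδ : cs.geometricRep x δ = -β := by
    rw [hδ, map_neg, geometricRep_apply_inv_self]
  -- Otherwise `β = -x α_k`, the very inversion lost in passing to `x s_k`.
  have hne (k : B) (hk : β ∈ cs.inversionSet (x * cs.simple k)) : δ ≠ simpleRoot k := by
    intro e
    rw [e] at hxδ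
    rw [← neg_eq_iff_eq_neg.2 hxδ] at hk
    exact cs.neg_geometricRep_simpleRoot_notMem_inversionSet_mul_simple x k hk
  have hi0 : 0 < δ i := by
    refine (hδpos.2 i).lt_of_ne fun h => hne j hβj ?_
    refine cs.eq_simpleRoot_of_mem_positiveRoots hδpos fun c hc => ?_
    by_cases hci : c = i
    · rw [hci, ← h]
    · exact hsupp c hci hc
  have hj0 : 0 < δ j := by
    refine (hδpos.2 j).lt_of_ne fun h => hne i hβi ?_
    refine cs.eq_simpleRoot_of_mem_positiveRoots hδpos fun c hc => ?_
    by_cases hcj : c = j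
    · rw [hcj, ← h]
    · exact hsupp c hc hcj
  -- `α_{i'}` is a positive combination of two distinct positive roots, which is absurd.
  have hroot (k : B) (hk : cs.IsRightDescent x k) :
      cs.geometricRep (w⁻¹ * x) (simpleRoot k) ∈ cs.positiveRoots := by
    have h := (cs.inversionSet_mono hxw (cs.neg_geometricRep_simpleRoot_mem_inversionSet hk)).2
    rwa [map_neg, ← geometricRep_mul_apply, ← neg_mem_positiveRoots_iff, neg_neg] at h
  have hcomb : simpleRoot i' = δ i • cs.geometricRep (w⁻¹ * x) (simpleRoot i) +
      δ j • cs.geometricRep (w⁻¹ * x) (simpleRoot j) := by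
    rw [← map_smul, ← map_smul, ← map_add, ← hδeq, geometricRep_mul_apply, hxδ, hβ, neg_neg,
      geometricRep_inv_apply_self]
  have hzero (c : B) (hc : c ≠ i') : cs.geometricRep (w⁻¹ * x) (simpleRoot i) c = 0 ∧
      cs.geometricRep (w⁻¹ * x) (simpleRoot j) c = 0 := by
    have h := DFunLike.congr_fun hcomb c
    simp only [simpleRoot, Finsupp.single_apply, hc.symm, if_false, Finsupp.add_apply,
      Finsupp.smul_apply, smul_eq_mul] at h
    have h1 := mul_nonneg hi0.le ((hroot i hi).2 c)
    have h2 := mul_nonneg hj0.le ((hroot j hj).2 c)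
    simp only [simpleRoot] at h1 h2 ⊢
    exact ⟨(mul_eq_zero.1 (by linarith)).resolve_left hi0.ne',
      (mul_eq_zero.1 (by linarith)).resolve_left hj0.ne'⟩
  have e := (cs.eq_simpleRoot_of_mem_positiveRoots (hroot i hi) fun c hc => (hzero c hc).1).trans
    (cs.eq_simpleRoot_of_mem_positiveRoots (hroot j hj) fun c hc => (hzero c hc).2).symm
  exact hij (Finsupp.single_left_injective one_ne_zero
    ((cs.geometricRep (w⁻¹ * x)).injective e))

theorem exists_least_prefixesInverting {w : W} {i : B} (hw : cs.IsRightDescent w i) :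
    ∃ j ∈ cs.prefixesInverting w (-cs.geometricRep w (simpleRoot i)),
      ∀ v ∈ cs.prefixesInverting w (-cs.geometricRep w (simpleRoot i)), j ≼[cs] v := by
  have htrans {a b c : W} (h : a ≼[cs] b) (h' : b ≼[cs] c) : a ≼[cs] c :=
    (rightWeakOrder cs).le_trans _ _ _ h h'
  obtain ⟨j, hj, -, hmin⟩ := exists_forall_le_of_locally_confluent
    (fun a b => a ≼[cs] b) (fun a b => ∃ i, cs.IsRightDescent b i ∧ a = b * cs.simple i)
    (rightWeakOrder cs).le_refl (fun _ _ _ h h' => htrans h h')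
    (cs.prefixesInverting w (-cs.geometricRep w (simpleRoot i))) cs.length
    (by
      rintro a - _ - ⟨i, hi, rfl⟩
      exact hi)
    (by
      rintro a _ ⟨i, hi, rfl⟩
      exact cs.weak_mul_simple_le hi)
    (by
      rintro a ⟨haw, -⟩ v ⟨hvw, hv⟩ hva hne
      obtain ⟨k, hk, hle⟩ := cs.exists_weak_le_mul_simple hva hne
      exact ⟨_, ⟨htrans (cs.weak_mul_simple_le hk) haw, cs.inversionSet_mono hle hv⟩,
        ⟨k, hk, rfl⟩, hle⟩)
    (by
      rintro a ⟨haw, -⟩ _ ⟨hkw, hk⟩ _ ⟨hlw, hl⟩ ⟨k, hak, rfl⟩ ⟨l, hal, rfl⟩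
      by_cases hkl : k = l
      · subst hkl
        exact ⟨_, ⟨hkw, hk⟩, (rightWeakOrder cs).le_refl _, (rightWeakOrder cs).le_refl _⟩
      obtain ⟨hM, z, haz, hlen⟩ := cs.exists_eq_mul_braidWord hkl hak hal
      have hzl := cs.weak_le_mul_simple_of_braidWord hM haz hlen
      have hzk : z ≼[cs] a * cs.simple k := by
        refine cs.weak_le_mul_simple_of_braidWord (i := l) (j := k) ?_ ?_ ?_
        · rwa [M.symmetric]
        · rwa [wordProd_braidWord_eq]
        · rwa [M.symmetric]
      exact ⟨z, ⟨htrans hzk hkw, cs.mem_inversionSet_of_mem_both haw hkl hak hal haz hk hl⟩,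
        hzk, hzl⟩)
    (x := w) ⟨(rightWeakOrder cs).le_refl w, cs.neg_geometricRep_simpleRoot_mem_inversionSet hw⟩
  exact ⟨j, hj, fun v hv => hmin v hv hv.1⟩

/-! ### The canonical join representation -/

theorem weak_le_of_isMinimalLengthIn {w j v : W} {β : B →₀ ℝ} (hβ : β ∈ cs.rightDescentRoots w)
    (hj : cs.IsMinimalLengthIn j (cs.prefixesInverting w β))
    (hv : v ∈ cs.prefixesInverting w β) : j ≼[cs] v := by
  obtain ⟨i, hi, rfl⟩ := hβ
  obtain ⟨j', hj', hmin⟩ := cs.exists_least_prefixesInverting hi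
  rw [← cs.eq_of_weak_le_of_length_le (hmin j hj.1) (hj.2 j' hj')]
  exact hmin v hv

theorem existsUnique_isMinimalLengthIn {w : W} {β : B →₀ ℝ} (hβ : β ∈ cs.rightDescentRoots w) :
    ∃! j : W, cs.IsMinimalLengthIn j (cs.prefixesInverting w β) := by
  obtain ⟨i, hi, rfl⟩ := hβ
  obtain ⟨j, hj, hmin⟩ := cs.exists_least_prefixesInverting hi
  refine ⟨j, ⟨hj, fun v hv => cs.length_le_of_weak_le (hmin v hv)⟩, fun j' hj' => ?_⟩
  exact (cs.eq_of_weak_le_of_length_le (hmin j' hj'.1) (hj'.2 j hj)).symm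

theorem isJoinRepresentation_canonicalJoinands (w : W) :
    @IsJoinRepresentation W cs.rightWeakOrder (cs.canonicalJoinands w) w := by
  refine ⟨?_, fun y hy => ?_⟩
  · rintro j ⟨β, -, hj⟩
    exact hj.1.1
  obtain ⟨m, hmw, hmy, hmax⟩ := cs.exists_weak_meet w y
  by_cases hm : m = w
  · rwa [hm] at hmy
  obtain ⟨i, hi, hle⟩ := cs.exists_weak_le_mul_simple hmw hm
  have hβ : -cs.geometricRep w (simpleRoot i) ∈ cs.rightDescentRoots w := ⟨i, hi, rfl⟩
  obtain ⟨j, hj, -⟩ := cs.existsUnique_isMinimalLengthIn hβ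
  have hjm := hmax j hj.1.1 (hy ⟨_, hβ, hj⟩)
  exact absurd (cs.inversionSet_mono hle (cs.inversionSet_mono hjm hj.1.2))
    (cs.neg_geometricRep_simpleRoot_notMem_inversionSet_mul_simple w i)

theorem weak_le_mul_simple_of_notMem_inversionSet {v w : W} {i : B} (hvw : v ≼[cs] w)
    (hv : -cs.geometricRep w (simpleRoot i) ∉ cs.inversionSet v) :
    v ≼[cs] w * cs.simple i := by
  refine cs.weak_le_of_inversionSet_subset fun γ hγ => ?_
  refine cs.mem_inversionSet_mul_simple (cs.inversionSet_mono hvw hγ) ?_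
  rintro rfl
  exact hv hγ

theorem joinRefines_canonicalJoinands {w : W} {V : Set W}
    (hV : @IsJoinRepresentation W cs.rightWeakOrder V w) :
    @JoinRefines W cs.rightWeakOrder (cs.canonicalJoinands w) V := by
  rintro j ⟨β, hβ, hj⟩
  obtain ⟨i, hi, rfl⟩ := id hβ
  by_contra! hlt
  have hle : w ≼[cs] w * cs.simple i := hV.2 fun v hv =>
    cs.weak_le_mul_simple_of_notMem_inversionSet (hV.1 hv) fun hβv =>
      hlt v hv (cs.weak_le_of_isMinimalLengthIn hβ hj ⟨hV.1 hv, hβv⟩)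
  exact absurd (cs.length_le_of_weak_le hle) (not_le.2 hi)

/-- For `γ ≠ β = -w α_i`, the element `w s_i` still inverts `γ`, so `j_γ` lies below it and cannot
invert `β`, whereas `j_β` does. -/
theorem eq_of_weak_le_of_mem_canonicalJoinands {w j j' : W} (hj : j ∈ cs.canonicalJoinands w)
    (hj' : j' ∈ cs.canonicalJoinands w) (hle : j ≼[cs] j') : j = j' := by
  obtain ⟨β, hβ, hj⟩ := hj
  obtain ⟨γ, hγ, hj'⟩ := hj'
  obtain rfl | hne := eq_or_ne β γ
  · exact (cs.existsUnique_isMinimalLengthIn hβ).unique hj hj'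
  obtain ⟨i, hi, rfl⟩ := id hβ
  obtain ⟨k, hk, rfl⟩ := id hγ
  have h1 := cs.mem_inversionSet_mul_simple
    (cs.neg_geometricRep_simpleRoot_mem_inversionSet hk) hne.symm
  have h2 := cs.weak_le_of_isMinimalLengthIn hγ hj' ⟨cs.weak_mul_simple_le hi, h1⟩
  exact absurd (cs.inversionSet_mono h2 (cs.inversionSet_mono hle hj.1.2))
    (cs.neg_geometricRep_simpleRoot_notMem_inversionSet_mul_simple w i)

theorem isCanonicalJoinRepresentation_canonicalJoinands (w : W) :
    @IsCanonicalJoinRepresentation W cs.rightWeakOrder (cs.canonicalJoinands w) w := by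
  refine @IsCanonicalJoinRepresentation.mk W cs.rightWeakOrder _ _
    (cs.isJoinRepresentation_canonicalJoinands w) ?_ fun V hV => cs.joinRefines_canonicalJoinands hV
  intro U hU hUw
  obtain ⟨j, hj, hjU⟩ := Set.exists_of_ssubset hU
  -- Refinement applies to `U` itself: the omitted `j` lies below some `u ∈ U`, and the antichain
  -- property forces `j = u`.
  obtain ⟨u, hu, hle⟩ := cs.joinRefines_canonicalJoinands hUw j hj
  exact hjU (cs.eq_of_weak_le_of_mem_canonicalJoinands hj (hU.1 hu) hle ▸ hu)

end CoxeterSystem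

theorem theorem1p1 {B : Type*} {W : Type*} [Group W] {M : CoxeterMatrix B}
    (cs : CoxeterSystem M W) (w : W) :
    (∀ β ∈ cs.rightDescentRoots w,
      ∃! j : W, cs.IsMinimalLengthIn j (cs.prefixesInverting w β)) ∧
    @IsCanonicalJoinRepresentation W cs.rightWeakOrder (cs.canonicalJoinands w) w :=
  ⟨fun _ => cs.existsUnique_isMinimalLengthIn, cs.isCanonicalJoinRepresentation_canonicalJoinands w⟩
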